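/- Let $m\ge 2$ be an integer and let $\mathbb F_{3^m}\subset\mathbb F_{3^{2m}}$ be the fields with $3^m$ and $3^{2m}$ elements, and let $\mathrm{Tr}$ be the trace map from $\mathbb F_{3^{2m}}$ to $\mathbb F_3$. Consider the ternary linear code $$\mathcal C(2m,3)=\Big\{\big(\mathrm{Tr}(at^{3^m+1}+bt)+h\big)_{t\in\mathbb F_{3^{2m}}} : a\in\mathbb F_{3^m},\ b\in\mathbb F_{3^{2m}},\ h\in\mathbb F_3\Big\}$$ and let $d$ be its minimum distance. Let $\mathbb D_d(\mathcal C(2m,3))$ be the incidence structure with point set $\mathbb F_{3^{2m}}$ whose blocks are the supports of the codewords of weight $d$ in $\mathcal C(2m,3)$, and let $\mathcal C_3(\mathbb D_d(\mathcal C(2m,3)))\subseteq\mathbb F_3^{\,\mathbb F_{3^{2m}}}$ be the code spanned over $\mathbb F_3$ by the rows of its (blocks by points) incidence matrix. For a primitive element $\xi$ of $\mathbb F_{3^{2m}}$ and $n=3^{2m}-1$, let $\mathcal R_3(4,2m)^*$ be the cyclic code of length $n$ over $\mathbb F_3$ with generator polynomial $\prod(x-\xi^i)$, the product over all $1\le i\le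 n-1$ whose sum of ternary digits is less than $4m-4$; let $\mathcal R_3(4,2m)$ be its extended code, obtained by adjoining to each codeword $(c_0,\dots,c_{n-1})$ the coordinate $c_n=-\sum_{i<n}c_i$. Its coordinates are indexed by $\mathbb F_{3^{2m}}$, with $c_i$ at the point $\xi^i$ for $i<n$ and $c_n$ at the point $0$. Then $\mathcal C_3(\mathbb D_d(\mathcal C(2m,3)))$ has length $3^{2m}$ and dimension $\frac{9m^2+7m}{2}+1$, it is a subcode of $\mathcal R_3(4,2m)$ for every primitive element $\xi$, and its minimum distance is at least $3^{2m-2}$. -/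

import Mathlib

namespace DesignCode

section General

variable {F ι : Type*} [Field F] [DecidableEq F] [Fintype ι]

/-- The minimum distance of a code `C ⊆ F^ι`: the least Hamming distance between two
different codewords. -/
noncomputable def minDist (C : Submodule F (ι → F)) : ℕ :=
  sInf {d | ∃ x ∈ C, ∃ y ∈ C, x ≠ y ∧ hammingDist x y = d}

/-- The block set of the support design `𝔻_w(C)`: the supports of the codewords of
weight `w`. It is a set, so there are no repeated blocks. -/
def supportBlocks (C : Submodule F (ι → F)) (w : ℕ) : Set (Set ι) :=
  {B | ∃ c ∈ C, hammingNorm c = w ∧ B = Function.support c}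

end General

section Incidence

variable (F : Type*) {ι : Type*} [Field F]

open Classical in
/-- The incidence matrix of the block set `𝓑` on the point set `ι`, with entries in `F`:
rows are indexed by blocks, columns by points. -/
noncomputable def incidenceMatrix (𝓑 : Set (Set ι)) : Matrix 𝓑 ι F :=
  Matrix.of fun B x => if x ∈ (B : Set ι) then 1 else 0

/-- The linear code over `F` of an incidence structure: the span of the rows of its
incidence matrix. -/
noncomputable def codeOfBlocks (𝓑 : Set (Set ι)) : Submodule F (ι → F) :=
  Submodule.span F (Set.range (incidenceMatrix F 𝓑).row)

end Incidence

section Hermitian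

variable (p m : ℕ) [Fact p.Prime] (K : Type*) [Field K] [Algebra (ZMod p) K]

/-- The word `c(a,b,h) = (Tr(a t^{p^m+1} + b t) + h)_{t ∈ K}`, where `Tr` is the trace
from `K` to the prime field. -/
noncomputable def hermitianWord (a b : K) (h : ZMod p) : K → ZMod p :=
  fun t => Algebra.trace (ZMod p) K (a * t ^ (p ^ m + 1) + b * t) + h

/-- The code `𝒞(2m,p) = {c(a,b,h) : a ∈ 𝔽_{p^m}, b ∈ K, h ∈ 𝔽_p}` for a field `K` with
`p^{2m}` elements; the subfield `𝔽_{p^m}` of `K` is the set of all `a` with `a^{p^m} = a`. -/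
noncomputable def hermitianCode : Submodule (ZMod p) (K → ZMod p) where
  carrier := {c | ∃ a b : K, ∃ h : ZMod p, a ^ p ^ m = a ∧ c = hermitianWord p m K a b h}
  zero_mem' := by
    refine ⟨0, 0, 0, ?_, ?_⟩
    · exact zero_pow (pow_ne_zero _ (Fact.out : p.Prime).ne_zero)
    · funext t
      simp [hermitianWord]
  add_mem' := by
    rintro _ _ ⟨a, b, h, ha, rfl⟩ ⟨a', b', h', ha', rfl⟩
    have : CharP K p := charP_of_injective_algebraMap (algebraMap (ZMod p) K).injective p
    refine ⟨a + a', b + b', h + h', ?_, ?_⟩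
    · rw [add_pow_char_pow, ha, ha']
    · funext t
      simp only [hermitianWord, Pi.add_apply, add_mul, map_add]
      ring
  smul_mem' := by
    rintro r _ ⟨a, b, h, ha, rfl⟩
    refine ⟨r • a, r • b, r * h, ?_, ?_⟩
    · rw [smul_pow, ha, ZMod.pow_card_pow]
    · funext t
      simp only [hermitianWord, Pi.smul_apply, smul_mul_assoc, map_add, map_smul, smul_eq_mul]
      ring

/-- The code `𝒞_p(𝔻_d(𝒞(2m,p)))`: the code over `𝔽_p` of the design whose blocks are the
supports of the codewords of `𝒞(2m,p)` of minimum weight `d`. -/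
noncomputable def hermitianDesignCode [Fintype K] : Submodule (ZMod p) (K → ZMod p) :=
  codeOfBlocks (ZMod p)
    (supportBlocks (hermitianCode p m K) (minDist (hermitianCode p m K)))

end Hermitian

section ReedMuller

open Polynomial

/-- The extended code of a code of length `n`: a last coordinate is adjoined so that the
sum of all coordinates is zero. -/
def extendedCode {F : Type*} [Field F] {n : ℕ} (C : Submodule F (Fin n → F)) :
    Submodule F (Fin (n + 1) → F) where
  carrier := {c | (fun i : Fin n => c i.castSucc) ∈ C ∧ ∑ i, c i = 0}
  zero_mem' := ⟨C.zero_mem, by simp⟩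
  add_mem' := by
    rintro c d ⟨hc, hc'⟩ ⟨hd, hd'⟩
    exact ⟨C.add_mem hc hd, by simp [Finset.sum_add_distrib, hc', hd']⟩
  smul_mem' := by
    rintro r c ⟨hc, hc'⟩
    exact ⟨C.smul_mem r hc, by simp [← Finset.mul_sum, hc']⟩

variable (p s l : ℕ) [Fact p.Prime] {K : Type*} [Field K] [Algebra (ZMod p) K] (ξ : K)

/-- The generator polynomial `∏ (X - ξ^i)` of the punctured generalized Reed-Muller code of
order `l` in `s` variables over `𝔽_p`; here `1 ≤ i ≤ p^s - 2` and the sum of the base `p` digits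
of `i` is less than `(p-1)s - l`. -/
noncomputable def grmGenerator : K[X] :=
  ∏ i ∈ (Finset.Icc 1 (p ^ s - 2)).filter (fun i => (p.digits i).sum + l < (p - 1) * s),
    (X - C (ξ ^ i))

/-- The word `(c_0, …, c_{n-1})` over `𝔽_p` read as the polynomial `∑ c_i X^i` over `K`. -/
noncomputable def wordPoly {n : ℕ} (c : Fin n → ZMod p) : K[X] :=
  ∑ i : Fin n, C (algebraMap (ZMod p) K (c i)) * X ^ (i : ℕ)

/-- The punctured generalized Reed-Muller code of order `l`: the cyclic code of length
`p^s - 1` over `𝔽_p` whose codewords are the multiples of the generator polynomial. (The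
generator polynomial divides `X^{p^s-1} - 1`, so being a multiple of it modulo `X^{p^s-1} - 1`
is the same as being a multiple of it.) -/
noncomputable def puncturedGRM : Submodule (ZMod p) (Fin (p ^ s - 1) → ZMod p) where
  carrier := {c | grmGenerator p s l ξ ∣ wordPoly p c}
  zero_mem' := by simp [wordPoly]
  add_mem' := by
    intro c d hc hd
    have h : (wordPoly p (c + d) : K[X]) = wordPoly p c + wordPoly p d := by
      simp [wordPoly, add_mul, Finset.sum_add_distrib]
    simpa only [Set.mem_ofPred_eq, h] using dvd_add hc hd
  smul_mem' := by
    intro r c hc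
    have h : (wordPoly p (r • c) : K[X]) = C (algebraMap (ZMod p) K r) * wordPoly p c := by
      simp [wordPoly, Finset.mul_sum, mul_assoc]
    simpa only [Set.mem_ofPred_eq, h] using Dvd.dvd.mul_left hc _

/-- The generalized Reed-Muller code `ℛ_p(l,s)`, the extended code of the punctured one, with
its coordinates indexed by `K`: coordinate `i < p^s - 1` is the point `ξ^i` and the adjoined
coordinate is the point `0`. -/
noncomputable def grmCode : Submodule (ZMod p) (K → ZMod p) :=
  (extendedCode (puncturedGRM p s l ξ)).comap
    (LinearMap.funLeft (ZMod p) (ZMod p)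
      (Fin.snoc (α := fun _ => K) (fun i : Fin (p ^ s - 1) => ξ ^ (i : ℕ)) 0))

end ReedMuller

end DesignCode

/-! Write `C` for the Hermitian code and `N t = t ^ (3 ^ m + 1)`. The theorem reduces to the
equality of the design code with `C * C`, the span of the products of two words of `C`
(`hermitianDesignCode_eq_mul`).

Over `𝔽₃` the indicator of the support of `w` is `w * w`, so the design code lies in `C * C`.
Conversely, the translates of `Tr(a N t) + u` with `a, u ≠ 0` have minimum weight: completing the
square reduces every word with `a ≠ 0` to such a form, and double counting shows that each form
takes the value `0` less often than `1` or `-1`. Varying the translation and `u` gives the squares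
of all words, and polarization gives all products.

After extension of scalars to `K`, `C` becomes the span of the monomials with exponents `0`, `3 ^
i`, `(3 ^ m + 1) * 3 ^ j` (expand the trace; invert with dual bases). Hence `C * C` becomes the span
of the monomials with exponents in `exponents m + exponents m`. No carries occur in these sums, so
the dimension is a count of digit vectors.

All these exponents have ternary digit sum at most `4`, while a power sum over `K` can be nonzero
only for exponents of digit sum at least `4m`. So the moments of order `i` vanish whenever the digit
sum of `i` is less than `4m - 4`. This is the Reed-Muller condition, and a run of consecutive
vanishing moments gives the distance bound by the BCH argument. -/

namespace DesignCode

/-! ### Traces, norms and the value distribution of the Hermitian forms -/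

section TraceForms

variable {K : Type*} [Field K] [Fintype K] [Algebra (ZMod 3) K]

theorem charP_three_of_algebra (K : Type*) [Field K] [Algebra (ZMod 3) K] : CharP K 3 :=
  charP_of_injective_algebraMap (algebraMap (ZMod 3) K).injective 3

theorem trace_pow_three_pow (k : ℕ) (x : K) :
    Algebra.trace (ZMod 3) K (x ^ 3 ^ k) = Algebra.trace (ZMod 3) K x := by
  induction k with
  | zero => simp
  | succ k ih =>
    rw [pow_succ, pow_mul, ← ih]
    have h := Algebra.trace_eq_of_algEquiv
      (FiniteField.frobeniusAlgEquivOfAlgebraic (ZMod 3) K) (x ^ 3 ^ k)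
    simpa [FiniteField.coe_frobeniusAlgEquivOfAlgebraic] using h

/-- The subfield of the elements fixed by `x ↦ x ^ 3 ^ m`, as a vector space over `𝔽₃`. -/
def frobeniusFixed (m : ℕ) (K : Type*) [Field K] [Algebra (ZMod 3) K] :
    Submodule (ZMod 3) K where
  carrier := {a | a ^ 3 ^ m = a}
  zero_mem' := zero_pow (by positivity)
  add_mem' := by
    intro a b ha hb
    have := charP_three_of_algebra K
    simp only [Set.mem_ofPred_eq] at *
    rw [add_pow_char_pow, ha, hb]
  smul_mem' := by
    intro r a ha
    simp only [Set.mem_ofPred_eq] at *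
    rw [smul_pow, ha, ZMod.pow_card_pow]

@[simp] theorem mem_frobeniusFixed {K : Type*} [Field K] [Algebra (ZMod 3) K] {m : ℕ} {a : K} :
    a ∈ frobeniusFixed m K ↔ a ^ 3 ^ m = a := Iff.rfl

variable {m : ℕ}

theorem pow_three_pow_pow {K : Type*} [Field K] [Fintype K]
    (hK : Fintype.card K = 3 ^ (2 * m)) (x : K) :
    (x ^ 3 ^ m) ^ 3 ^ m = x := by
  rw [← pow_mul, ← pow_add, ← two_mul, ← hK, FiniteField.pow_card]

theorem norm_mem_frobeniusFixed (hK : Fintype.card K = 3 ^ (2 * m)) (t : K) :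
    t ^ (3 ^ m + 1) ∈ frobeniusFixed m K := by
  rw [mem_frobeniusFixed, ← pow_mul, add_mul, pow_add, one_mul, pow_mul,
    pow_three_pow_pow hK, pow_succ, mul_comm]

theorem trace_mul_surjective {b : K} (hb : b ≠ 0) :
    ∃ t : K, Algebra.trace (ZMod 3) K (b * t) ≠ 0 := by
  obtain ⟨x, hx⟩ := Algebra.trace_surjective (ZMod 3) K 1
  exact ⟨b⁻¹ * x, by rw [mul_inv_cancel_left₀ hb, hx]; exact one_ne_zero⟩

theorem exists_frobeniusFixed_trace_mul_ne_zero (hK : Fintype.card K = 3 ^ (2 * m)) {y : K}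
    (hy : y ∈ frobeniusFixed m K) (hy0 : y ≠ 0) :
    ∃ a ∈ frobeniusFixed m K, Algebra.trace (ZMod 3) K (a * y) ≠ 0 := by
  have := charP_three_of_algebra K
  obtain ⟨x, hx⟩ := Algebra.trace_surjective (ZMod 3) K 1
  -- The relative trace `x + x ^ 3 ^ m` lies in the subfield and has absolute trace `2 * Tr x = 2`.
  refine ⟨(x + x ^ 3 ^ m) * y⁻¹, ?_, ?_⟩
  · rw [mem_frobeniusFixed] at *
    rw [mul_pow, inv_pow, hy, add_pow_char_pow, pow_three_pow_pow hK, add_comm]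
  · rw [inv_mul_cancel_right₀ hy0, map_add, trace_pow_three_pow, hx]
    decide

theorem exists_generator_orderOf (hK : Fintype.card K = 3 ^ (2 * m)) :
    1 < 3 ^ m ∧ ∃ g : Kˣ, (∀ x, x ∈ Subgroup.zpowers g) ∧
      orderOf g = (3 ^ m - 1) * (3 ^ m + 1) ∧
      ∀ x : Kˣ, (x : K) ∈ frobeniusFixed m K → x ^ (3 ^ m - 1) = 1 := by
  classical
  have h3 : 1 < 3 ^ m := by
    refine Nat.one_lt_pow ?_ (by norm_num)
    rintro rfl
    have : Fintype.card K = 1 := by simpa using hK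
    have := Fintype.one_lt_card (α := K)
    omega
  obtain ⟨g, hg⟩ := IsCyclic.exists_generator (α := Kˣ)
  refine ⟨h3, g, hg, ?_, fun x hx => ?_⟩
  · rw [orderOf_eq_card_of_forall_mem_zpowers hg, Nat.card_eq_fintype_card,
      Fintype.card_units, hK, mul_comm 2, pow_mul, mul_comm (3 ^ m - 1), ← Nat.sq_sub_sq, one_pow]
  · have h2 : x ^ (3 ^ m - 1) * x = x := by
      rw [← pow_succ, Nat.sub_add_cancel h3.le]
      ext
      simpa using hx
    simpa using h2

/-- Surjectivity of the norm: in a cyclic group of order `(q - 1)(q + 1)`, the elements killed by `q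
- 1` are the `(q + 1)`-th powers. -/
theorem exists_pow_eq_of_mem_frobeniusFixed (hK : Fintype.card K = 3 ^ (2 * m)) {a : K}
    (ha : a ∈ frobeniusFixed m K) (ha0 : a ≠ 0) : ∃ μ : K, μ ≠ 0 ∧ μ ^ (3 ^ m + 1) = a := by
  obtain ⟨h3, g, hg, hord, hfix⟩ := exists_generator_orderOf hK
  obtain ⟨j, hj⟩ := mem_powers_iff_mem_zpowers.mpr (hg (Units.mk0 a ha0))
  have h1 := hfix (Units.mk0 a ha0) ha
  simp only at hj
  rw [← hj, ← pow_mul, ← orderOf_dvd_iff_pow_eq_one, hord, mul_comm j] at h1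
  obtain ⟨k, rfl⟩ := Nat.dvd_of_mul_dvd_mul_left (by omega) h1
  refine ⟨(g : K) ^ k, pow_ne_zero _ g.ne_zero, ?_⟩
  rw [← pow_mul, mul_comm]
  simpa using congrArg Units.val hj

theorem card_frobeniusFixed_lt (hK : Fintype.card K = 3 ^ (2 * m))
    [Fintype (frobeniusFixed m K)] : Fintype.card (frobeniusFixed m K) < Fintype.card K := by
  obtain ⟨h3, g, -, hord, hfix⟩ := exists_generator_orderOf hK
  refine Fintype.card_subtype_lt (x := (g : K)) fun h => ?_
  have h1 := hfix g h
  rw [← orderOf_dvd_iff_pow_eq_one, hord] at h1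
  have := Nat.le_of_dvd (by omega) h1
  nlinarith [Nat.sub_add_cancel h3.le, Nat.sub_pos_of_lt h3]

/-- All fibres of a nonzero functional to `𝔽₃` have the same size. -/
theorem three_mul_card_fiber {V : Type*} [AddCommGroup V] [Fintype V] (φ : V →+ ZMod 3) {v : V}
    (hv : φ v ≠ 0) (u : ZMod 3) :
    3 * (Finset.univ.filter fun x => φ x = u).card = Fintype.card V := by
  classical
  have hsurj : ∀ w : ZMod 3, w ∈ Set.range φ := by
    intro w
    refine ⟨(w * (φ v)⁻¹).val • v, ?_⟩
    rw [map_nsmul, nsmul_eq_mul, ZMod.natCast_val, ZMod.cast_id, inv_mul_cancel_right₀ hv]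
  have h := Finset.card_eq_sum_card_fiberwise (f := φ) (s := Finset.univ) (t := Finset.univ)
    (fun _ _ => by simp)
  rw [Finset.card_univ] at h
  rw [h, Finset.sum_congr rfl fun w _ =>
    AddMonoidHom.card_fiber_eq_of_mem_range φ (hsurj w) (hsurj u)]
  simp [ZMod.card]

/-- The number of points where the Hermitian form `Tr(a t^{3^m+1})` takes the value `u`. -/
noncomputable def valueCount (m : ℕ) (a : K) (u : ZMod 3) : ℕ :=
  (Finset.univ.filter fun t : K => Algebra.trace (ZMod 3) K (a * t ^ (3 ^ m + 1)) = u).card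

/-- If `a` is the norm of `μ`, the substitution `t ↦ μ t` carries one form to the other. -/
theorem valueCount_eq_one (hK : Fintype.card K = 3 ^ (2 * m)) {a : K}
    (ha : a ∈ frobeniusFixed m K) (ha0 : a ≠ 0) (u : ZMod 3) :
    valueCount m a u = valueCount m (1 : K) u := by
  obtain ⟨μ, hμ, rfl⟩ := exists_pow_eq_of_mem_frobeniusFixed hK ha ha0
  refine Finset.card_bij (fun t _ => μ * t) ?_ ?_ ?_
  · intro t ht
    simpa [mul_pow] using ht
  · intro s _ t _ h
    exact mul_left_cancel₀ hμ h
  · intro t ht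
    refine ⟨μ⁻¹ * t, ?_, mul_inv_cancel_left₀ hμ t⟩
    simp only [Finset.mem_filter, Finset.mem_univ, true_and, one_mul] at ht ⊢
    rwa [← mul_pow, mul_inv_cancel_left₀ hμ]

theorem valueCount_neg (a : K) (u : ZMod 3) : valueCount m a (-u) = valueCount m (-a) u := by
  unfold valueCount
  congr 1
  ext t
  simp [neg_eq_iff_eq_neg]

theorem one_mem_frobeniusFixed {K : Type*} [Field K] [Algebra (ZMod 3) K] :
    (1 : K) ∈ frobeniusFixed m K := by simp

theorem valueCount_eq_of_ne_zero (hK : Fintype.card K = 3 ^ (2 * m)) {a : K}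
    (ha : a ∈ frobeniusFixed m K) (ha0 : a ≠ 0) {u : ZMod 3} (hu : u ≠ 0) :
    valueCount m a u = valueCount m (1 : K) 1 := by
  have : ∀ u : ZMod 3, u ≠ 0 → u = 1 ∨ u = -1 := by decide
  rcases this u hu with rfl | rfl
  · exact valueCount_eq_one hK ha ha0 1
  · rw [valueCount_neg]
    exact valueCount_eq_one hK (Submodule.neg_mem _ ha) (neg_ne_zero.mpr ha0) 1

theorem valueCount_zero_add (hK : Fintype.card K = 3 ^ (2 * m)) :
    valueCount m (1 : K) 0 + 2 * valueCount m (1 : K) 1 = Fintype.card K := by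
  classical
  have h := Finset.card_eq_sum_card_fiberwise
    (f := fun t : K => Algebra.trace (ZMod 3) K (1 * t ^ (3 ^ m + 1)))
    (s := Finset.univ) (t := Finset.univ) (fun _ _ => by simp)
  have h2 : (Finset.univ : Finset (ZMod 3)) = {0, 1, 2} := by decide
  rw [Finset.card_univ, h2] at h
  rw [h, Finset.sum_insert (by decide), Finset.sum_insert (by decide), Finset.sum_singleton]
  have := valueCount_eq_of_ne_zero (a := (1 : K)) (u := 2) hK one_mem_frobeniusFixed one_ne_zero
    (by decide)
  unfold valueCount at *
  rw [this]
  ring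

theorem sum_ite_zero {V : Type*} [Fintype V] [Zero V] [DecidableEq V] (A B : ℕ) :
    (∑ x : V, if x = 0 then A else B) = A + (Fintype.card V - 1) * B := by
  rw [Fintype.sum_eq_add_sum_compl (0 : V), if_pos rfl,
    Finset.sum_congr rfl (g := fun _ => B) fun x hx => if_neg (by simpa using hx),
    Finset.sum_const, Finset.card_compl, Finset.card_singleton, smul_eq_mul]

/-- Double counting of the pairs `(a, t)` with `Tr(a N t) = 0`, `a` in the subfield. With `s`, `n`
the orders of the subfield and of `K`, and `z` the count of zeros, it gives `3n + 3(s - 1)z = 3s +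
(n - 1)s`, that is, `3(s - 1)z = (s - 1)n - 2(n - s)`, and `s < n`. -/
theorem three_mul_valueCount_zero_lt (hK : Fintype.card K = 3 ^ (2 * m)) :
    3 * valueCount m (1 : K) 0 < Fintype.card K := by
  classical
  let S := frobeniusFixed m K
  let _ : Fintype S := Fintype.ofFinite S
  have hdc := Finset.sum_card_bipartiteAbove_eq_sum_card_bipartiteBelow
    (s := (Finset.univ : Finset S)) (t := (Finset.univ : Finset K))
    (fun (a : S) t => Algebra.trace (ZMod 3) K ((a : K) * t ^ (3 ^ m + 1)) = 0)
  have hL : ∀ a : S, ((Finset.univ : Finset K).bipartiteAbove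
      (fun (a : S) t => Algebra.trace (ZMod 3) K ((a : K) * t ^ (3 ^ m + 1)) = 0) a).card
      = if a = 0 then Fintype.card K else valueCount m (1 : K) 0 := by
    intro a
    split_ifs with h
    · subst h
      simp [Finset.bipartiteAbove]
    · exact valueCount_eq_one hK a.2 (by simpa using h) 0
  have hR : ∀ t : K, 3 * ((Finset.univ : Finset S).bipartiteBelow
      (fun (a : S) t => Algebra.trace (ZMod 3) K ((a : K) * t ^ (3 ^ m + 1)) = 0) t).card
      = if t = 0 then 3 * Fintype.card S else Fintype.card S := by
    intro t
    split_ifs with h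
    · subst h
      simp [Finset.bipartiteBelow]
    · obtain ⟨a, ha, hne⟩ := exists_frobeniusFixed_trace_mul_ne_zero hK
        (norm_mem_frobeniusFixed hK t) (pow_ne_zero _ h)
      exact three_mul_card_fiber
        (((Algebra.trace (ZMod 3) K).comp
          ((LinearMap.mulRight (ZMod 3) (t ^ (3 ^ m + 1))).comp S.subtype)).toAddMonoidHom)
        (v := ⟨a, ha⟩) hne 0
  rw [Finset.sum_congr rfl fun a _ => hL a] at hdc
  have hdc3 := congrArg (3 * ·) hdc
  rw [Finset.mul_sum Finset.univ (fun t : K => _) 3, Finset.sum_congr rfl fun t _ => hR t,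
    sum_ite_zero, sum_ite_zero] at hdc3
  have hlt : Fintype.card S < Fintype.card K := card_frobeniusFixed_lt hK
  have hS : 1 < Fintype.card S := Fintype.one_lt_card_iff.mpr
    ⟨0, ⟨1, one_mem_frobeniusFixed⟩, by simp [Subtype.ext_iff]⟩
  obtain ⟨k, hk⟩ : ∃ k, Fintype.card S = k + 1 := ⟨_, (Nat.sub_add_cancel hS.le).symm⟩
  obtain ⟨n, hn⟩ : ∃ n, Fintype.card K = n + 1 :=
    ⟨_, (Nat.sub_add_cancel (hS.trans hlt).le).symm⟩
  rw [hk, hn] at hdc3 hlt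
  rw [hk] at hS
  rw [hn]
  simp only [Nat.add_sub_cancel] at hdc3
  have hk0 : 0 < k := by omega
  refine lt_of_mul_lt_mul_left (a := k) ?_ (Nat.zero_le k)
  nlinarith

end TraceForms

/-! ### Minimum weight words, and the design code as a square -/

section HermitianWords

variable {K : Type*} [Field K] [Fintype K] [Algebra (ZMod 3) K] {m : ℕ}

/-- The two cross terms in the expansion of the norm are conjugate under `x ↦ x ^ 3 ^ m`, so their
traces agree; this produces the factor `2`. -/
theorem hermitianWord_add_right (hK : Fintype.card K = 3 ^ (2 * m)) {a : K}
    (ha : a ∈ frobeniusFixed m K) (u : ZMod 3) (c t : K) :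
    hermitianWord 3 m K a 0 u (t + c) =
      hermitianWord 3 m K a (2 * a * c ^ 3 ^ m)
        (u + Algebra.trace (ZMod 3) K (a * c ^ (3 ^ m + 1))) t := by
  have := charP_three_of_algebra K
  rw [mem_frobeniusFixed] at ha
  have h1 : Algebra.trace (ZMod 3) K (a * t ^ 3 ^ m * c) =
      Algebra.trace (ZMod 3) K (a * t * c ^ 3 ^ m) := by
    rw [← trace_pow_three_pow m, mul_pow, mul_pow, ha, pow_three_pow_pow hK]
  have h2 : a * (t + c) ^ (3 ^ m + 1) = a * t ^ (3 ^ m + 1) + a * t ^ 3 ^ m * c +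
      a * t * c ^ 3 ^ m + a * c ^ (3 ^ m + 1) := by
    rw [pow_succ, add_pow_char_pow]
    ring
  have h3 : 2 * a * c ^ 3 ^ m * t = a * t * c ^ 3 ^ m + a * t * c ^ 3 ^ m := by ring
  simp only [hermitianWord, zero_mul, add_zero, h2, h3, map_add, h1]
  ring

theorem exists_two_mul_mul_pow_eq (hK : Fintype.card K = 3 ^ (2 * m)) {a : K} (ha0 : a ≠ 0)
    (b : K) : ∃ c : K, 2 * a * c ^ 3 ^ m = b := by
  have := charP_three_of_algebra K
  have h2 : (2 : K) ≠ 0 := by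
    have h : (1 : K) + 2 = 0 := by
      have := CharP.cast_eq_zero K 3
      push_cast at this
      linear_combination this
    intro h'
    rw [h', add_zero] at h
    exact one_ne_zero h
  refine ⟨(b / (2 * a)) ^ 3 ^ m, ?_⟩
  rw [pow_three_pow_pow hK, mul_div_cancel₀ _ (mul_ne_zero h2 ha0)]

theorem hammingNorm_add_card_zeros {ι : Type*} [Fintype ι] (w : ι → ZMod 3) :
    hammingNorm w + (Finset.univ.filter fun t => w t = 0).card = Fintype.card ι := by
  rw [hammingNorm, add_comm, ← Finset.card_univ]
  exact Finset.card_filter_add_card_filter_not _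

theorem hammingNorm_comp_add_right {K : Type*} [AddGroup K] [Fintype K] (w : K → ZMod 3) (c : K) :
    hammingNorm (fun t => w (t + c)) = hammingNorm w := by
  refine Finset.card_bij (fun t _ => t + c) ?_ ?_ ?_
  · intro t ht
    simpa using ht
  · intro s _ t _ h
    exact add_right_cancel h
  · intro t ht
    exact ⟨t - c, by simpa using ht, sub_add_cancel t c⟩

theorem hammingNorm_form_add_valueCount (a : K) (u : ZMod 3) :
    hammingNorm (hermitianWord 3 m K a 0 u) + valueCount m a (-u) = Fintype.card K := by
  rw [← hammingNorm_add_card_zeros (hermitianWord 3 m K a 0 u), valueCount]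
  simp only [hermitianWord, zero_mul, add_zero, eq_neg_iff_add_eq_zero]

theorem hammingNorm_form (hK : Fintype.card K = 3 ^ (2 * m)) {a : K}
    (ha : a ∈ frobeniusFixed m K) (ha0 : a ≠ 0) {u : ZMod 3} (hu : u ≠ 0) :
    hammingNorm (hermitianWord 3 m K a 0 u) + valueCount m (1 : K) 1 = Fintype.card K := by
  rw [← hammingNorm_form_add_valueCount (m := m) a u,
    valueCount_eq_of_ne_zero hK ha ha0 (neg_ne_zero.mpr hu)]

/-- A nonzero word has no zeros (constant), `|K| / 3` zeros (affine), or, after completing the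
square, as many zeros as a form takes `0` or a nonzero value. The last number is the largest,
because `0` is taken fewer than `|K| / 3` times. -/
theorem card_le_hammingNorm_add (hK : Fintype.card K = 3 ^ (2 * m)) {a b : K} {h : ZMod 3}
    (ha : a ∈ frobeniusFixed m K) (hw : hermitianWord 3 m K a b h ≠ 0) :
    Fintype.card K ≤ hammingNorm (hermitianWord 3 m K a b h) + valueCount m (1 : K) 1 := by
  have e1 := valueCount_zero_add hK
  have e2 := three_mul_valueCount_zero_lt hK
  by_cases ha0 : a = 0
  · have e3 := hammingNorm_add_card_zeros (hermitianWord 3 m K a b h)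
    by_cases hb : b = 0
    · subst ha0 hb
      have hh : h ≠ 0 := by
        rintro rfl
        exact hw (by funext t; simp [hermitianWord])
      have : (Finset.univ.filter fun t : K => hermitianWord 3 m K 0 0 h t = 0).card = 0 := by
        simp [hermitianWord, hh]
      omega
    · subst ha0
      obtain ⟨t, ht⟩ := trace_mul_surjective hb
      have := three_mul_card_fiber ((Algebra.trace (ZMod 3) K).comp
        (LinearMap.mulLeft (ZMod 3) b)).toAddMonoidHom (v := t) ht (-h)
      have h4 : (Finset.univ.filter fun t : K => hermitianWord 3 m K 0 b h t = 0).card =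
          (Finset.univ.filter fun t : K => ((Algebra.trace (ZMod 3) K).comp
            (LinearMap.mulLeft (ZMod 3) b)).toAddMonoidHom t = -h).card := by
        congr 1
        ext t
        simp [hermitianWord, eq_neg_iff_add_eq_zero]
      omega
  · obtain ⟨c, hc⟩ := exists_two_mul_mul_pow_eq hK ha0 b
    have hshift : hermitianWord 3 m K a b h = fun t => hermitianWord 3 m K a 0
        (h - Algebra.trace (ZMod 3) K (a * c ^ (3 ^ m + 1))) (t + c) := by
      funext t
      rw [hermitianWord_add_right hK ha, hc, sub_add_cancel]
    rw [hshift, hammingNorm_comp_add_right]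
    generalize h - Algebra.trace (ZMod 3) K (a * c ^ (3 ^ m + 1)) = u
    by_cases hu : u = 0
    · subst hu
      have := hammingNorm_form_add_valueCount (m := m) a 0
      rw [neg_zero, valueCount_eq_one hK ha ha0] at this
      omega
    · exact (hammingNorm_form hK ha ha0 hu).ge

theorem hermitianWord_mem {K : Type*} [Field K] [Algebra (ZMod 3) K] {a : K}
    (ha : a ∈ frobeniusFixed m K) (b : K) (h : ZMod 3) :
    hermitianWord 3 m K a b h ∈ hermitianCode 3 m K := ⟨a, b, h, ha, rfl⟩

theorem minDist_hermitianCode (hK : Fintype.card K = 3 ^ (2 * m)) :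
    minDist (hermitianCode 3 m K) + valueCount m (1 : K) 1 = Fintype.card K := by
  have e1 := valueCount_zero_add hK
  have e2 := three_mul_valueCount_zero_lt hK
  have hform := hammingNorm_form hK one_mem_frobeniusFixed one_ne_zero (one_ne_zero (α := ZMod 3))
  suffices h : minDist (hermitianCode 3 m K) = hammingNorm (hermitianWord 3 m K 1 0 1) by
    rw [h, hform]
  apply le_antisymm
  · refine Nat.sInf_le ⟨_, hermitianWord_mem one_mem_frobeniusFixed 0 1, 0, Submodule.zero_mem _,
      ?_, hammingDist_zero_right _⟩
    rw [← hammingNorm_pos_iff]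
    omega
  · refine le_csInf ⟨_, _, hermitianWord_mem one_mem_frobeniusFixed 0 1, 0, Submodule.zero_mem _,
      ?_, rfl⟩ ?_
    · rw [← hammingNorm_pos_iff]
      omega
    · rintro _ ⟨x, hx, y, hy, hxy, rfl⟩
      obtain ⟨a, b, h, ha, hw⟩ := Submodule.sub_mem _ hx hy
      rw [hammingDist_comm, hammingDist_eq_hammingNorm, neg_add_eq_sub, hw]
      have := card_le_hammingNorm_add hK (b := b) (h := h) ha (by
        rw [← hw]; exact sub_ne_zero.mpr hxy)
      omega

theorem incidenceMatrix_row_support {ι : Type*} {𝓑 : Set (Set ι)} (w : ι → ZMod 3)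
    (h : Function.support w ∈ 𝓑) :
    (incidenceMatrix (ZMod 3) 𝓑).row ⟨Function.support w, h⟩ = w * w := by
  have key : ∀ x : ZMod 3, x ≠ 0 → 1 = x * x := by decide
  funext t
  by_cases ht : w t = 0
  · simp [incidenceMatrix, Matrix.row, ht]
  · simpa [incidenceMatrix, Matrix.row, ht] using key _ ht

theorem form_mul_self_mem (hK : Fintype.card K = 3 ^ (2 * m)) {a : K}
    (ha : a ∈ frobeniusFixed m K) (ha0 : a ≠ 0) {u : ZMod 3} (hu : u ≠ 0) (c : K) :
    (fun t => hermitianWord 3 m K a 0 u (t + c)) * (fun t => hermitianWord 3 m K a 0 u (t + c)) ∈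
      hermitianDesignCode 3 m K := by
  have hB : Function.support (fun t => hermitianWord 3 m K a 0 u (t + c)) ∈
      supportBlocks (hermitianCode 3 m K) (minDist (hermitianCode 3 m K)) := by
    refine ⟨_, ?_, ?_, rfl⟩
    · refine ⟨_, _, _, ha, funext fun t => hermitianWord_add_right hK ha u c t⟩
    · rw [hammingNorm_comp_add_right]
      have h1 := minDist_hermitianCode hK
      have h2 := hammingNorm_form hK ha ha0 hu
      omega
  rw [← incidenceMatrix_row_support _ hB]
  exact Submodule.subset_span ⟨_, rfl⟩

theorem hermitianDesignCode_le : hermitianDesignCode 3 m K ≤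
    hermitianCode 3 m K * hermitianCode 3 m K := by
  refine Submodule.span_le.mpr ?_
  rintro _ ⟨⟨B, hB⟩, rfl⟩
  have hB' := hB
  obtain ⟨c, hc, -, rfl⟩ := hB'
  rw [incidenceMatrix_row_support]
  exact Submodule.mul_mem_mul hc hc

theorem mem_of_const_mul_mem {X : Type*} {M : Submodule (ZMod 3) (X → ZMod 3)} {f g : X → ZMod 3}
    {r : ZMod 3} (hg : g ∈ M) (h : ∀ t, f t = r * g t) : f ∈ M := by
  have : f = r • g := funext h
  rw [this]
  exact Submodule.smul_mem _ _ hg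

/-- The square of every word of the Hermitian code lies in the code of the design. -/
theorem word_mul_self_mem (hK : Fintype.card K = 3 ^ (2 * m)) {w : K → ZMod 3}
    (hw : w ∈ hermitianCode 3 m K) : w * w ∈ hermitianDesignCode 3 m K := by
  set M := hermitianDesignCode 3 m K with hM
  let tr := Algebra.trace (ZMod 3) K
  let N : K → K := fun t => t ^ (3 ^ m + 1)
  have three : (3 : ZMod 3) = 0 := by decide
  -- the forms `Q_a(t + c) = Q + L + k` and their squares
  have hexp : ∀ a ∈ frobeniusFixed m K, ∀ c t u, hermitianWord 3 m K a 0 u (t + c) =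
      tr (a * N t) + tr (2 * a * c ^ 3 ^ m * t) + tr (a * N c) + u := by
    intro a ha c t u
    rw [hermitianWord_add_right hK ha]
    simp only [hermitianWord, map_add, N, tr]
    ring
  have hmem : ∀ a ∈ frobeniusFixed m K, a ≠ 0 → ∀ c u, u ≠ 0 →
      (fun t => (tr (a * N t) + tr (2 * a * c ^ 3 ^ m * t) + tr (a * N c) + u) ^ 2) ∈ M := by
    intro a ha ha0 c u hu
    have := form_mul_self_mem hK ha ha0 hu c
    convert this using 1
    funext t
    simp only [Pi.mul_apply, hexp a ha c, sq]
  -- `(P + 1)² - (P - 1)² = 4P = P` in characteristic 3.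
  have hP : ∀ a ∈ frobeniusFixed m K, a ≠ 0 → ∀ c,
      (fun t => tr (a * N t) + tr (2 * a * c ^ 3 ^ m * t) + tr (a * N c)) ∈ M := by
    intro a ha ha0 c
    convert Submodule.sub_mem _ (hmem a ha ha0 c 1 (by decide)) (hmem a ha ha0 c (-1) (by decide))
      using 1
    funext t
    simp only [Pi.sub_apply]
    linear_combination -(tr (a * N t) + tr (2 * a * c ^ 3 ^ m * t) + tr (a * N c)) * three
  have hN0 : N 0 = 0 := by simp [N]
  have hNneg : ∀ c, N (-c) = N c := fun c => by
    simp only [N]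
    rw [Even.neg_pow]
    exact Odd.add_one (Odd.pow (by decide))
  have hneg : ∀ c : K, (-c) ^ 3 ^ m = -(c ^ 3 ^ m) := fun c => Odd.neg_pow (Odd.pow (by decide)) c
  have hQ : ∀ a ∈ frobeniusFixed m K, a ≠ 0 → (fun t => tr (a * N t)) ∈ M := by
    intro a ha ha0
    simpa [hN0] using hP a ha ha0 0
  -- The translates by `1` and `-1` have opposite linear parts; their sum minus `2Q` is the constant
  -- `2 Tr(a)`, nonzero for suitable `a`.
  have hone : (fun _ => 1 : K → ZMod 3) ∈ M := by
    obtain ⟨a, ha, hne⟩ := exists_frobeniusFixed_trace_mul_ne_zero hK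
      (one_mem_frobeniusFixed (m := m) (K := K)) one_ne_zero
    have ha0 : a ≠ 0 := by
      rintro rfl
      simp at hne
    have h := Submodule.sub_mem _ (Submodule.add_mem _ (hP a ha ha0 1) (hP a ha ha0 (-1)))
      (Submodule.smul_mem _ 2 (hQ a ha ha0))
    refine mem_of_const_mul_mem (r := (2 * tr (a * 1))⁻¹) h fun t => ?_
    have h2 : (2 : ZMod 3) * tr (a * 1) ≠ 0 := mul_ne_zero (by decide) hne
    rw [eq_inv_mul_iff_mul_eq₀ h2]
    simp only [Pi.sub_apply, Pi.add_apply, Pi.smul_apply, smul_eq_mul, hneg, hNneg, mul_neg,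
      neg_mul, map_neg]
    simp only [N, one_pow]
    ring
  have hL : ∀ b, (fun t => tr (b * t)) ∈ M := by
    intro b
    obtain ⟨c, rfl⟩ := exists_two_mul_mul_pow_eq hK (one_ne_zero (α := K)) b
    have h := Submodule.sub_mem _ (hP 1 one_mem_frobeniusFixed one_ne_zero (-c))
      (hP 1 one_mem_frobeniusFixed one_ne_zero c)
    convert h using 1
    funext t
    simp only [Pi.sub_apply, hneg, hNneg, mul_neg, neg_mul, map_neg]
    linear_combination tr (2 * 1 * c ^ 3 ^ m * t) * three
  have hPP : ∀ a ∈ frobeniusFixed m K, a ≠ 0 → ∀ c,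
      (fun t => (tr (a * N t) + tr (2 * a * c ^ 3 ^ m * t) + tr (a * N c)) ^ 2) ∈ M := by
    intro a ha ha0 c
    convert Submodule.sub_mem _ (Submodule.sub_mem _ (hmem a ha ha0 c 1 one_ne_zero)
      (Submodule.smul_mem _ 2 (hP a ha ha0 c))) hone using 1
    funext t
    simp only [Pi.sub_apply, Pi.smul_apply, smul_eq_mul]
    ring
  have hQQ : ∀ a ∈ frobeniusFixed m K, a ≠ 0 → (fun t => tr (a * N t) ^ 2) ∈ M := by
    intro a ha ha0
    simpa [hN0] using hPP a ha ha0 0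
  -- With `k = Tr(a N c)`, `(Q + L + k)² - (Q - L + k)² = 4L(Q + k) = QL + kL`.
  have hQL : ∀ a ∈ frobeniusFixed m K, a ≠ 0 → ∀ b,
      (fun t => tr (a * N t) * tr (b * t)) ∈ M := by
    intro a ha ha0 b
    obtain ⟨c, rfl⟩ := exists_two_mul_mul_pow_eq hK ha0 b
    convert Submodule.sub_mem _ (Submodule.sub_mem _ (hPP a ha ha0 c) (hPP a ha ha0 (-c)))
      (Submodule.smul_mem _ (tr (a * N c)) (hL (2 * a * c ^ 3 ^ m))) using 1
    funext t
    simp only [Pi.sub_apply, Pi.smul_apply, smul_eq_mul, hneg, hNneg, mul_neg, neg_mul, map_neg]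
    linear_combination -(tr (a * N t) * tr (2 * a * c ^ 3 ^ m * t) +
      tr (2 * a * c ^ 3 ^ m * t) * tr (a * N c)) * three
  -- All other terms of `(Q + L + k)²` are already in `M`.
  have hLL : ∀ b, (fun t => tr (b * t) ^ 2) ∈ M := by
    intro b
    obtain ⟨c, rfl⟩ := exists_two_mul_mul_pow_eq hK (one_ne_zero (α := K)) b
    have ha := one_mem_frobeniusFixed (m := m) (K := K)
    set k := tr (1 * N c) with hk
    convert Submodule.sub_mem _ (Submodule.sub_mem _ (Submodule.sub_mem _ (Submodule.sub_mem _
      (Submodule.sub_mem _ (hPP 1 ha one_ne_zero c) (hQQ 1 ha one_ne_zero))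
      (Submodule.smul_mem _ (2 * k) (hQ 1 ha one_ne_zero)))
      (Submodule.smul_mem _ 2 (hQL 1 ha one_ne_zero (2 * 1 * c ^ 3 ^ m))))
      (Submodule.smul_mem _ (2 * k) (hL (2 * 1 * c ^ 3 ^ m))))
      (Submodule.smul_mem _ (k ^ 2) hone) using 1
    funext t
    simp only [Pi.sub_apply, Pi.smul_apply, smul_eq_mul, ← hk]
    ring
  obtain ⟨a, b, h, ha, rfl⟩ := hw
  have hlin : (fun t => (tr (b * t) + h) ^ 2) ∈ M := by
    convert Submodule.add_mem _ (Submodule.add_mem _ (hLL b)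
      (Submodule.smul_mem _ (2 * h) (hL b))) (Submodule.smul_mem _ (h ^ 2) hone) using 1
    funext t
    simp only [Pi.add_apply, Pi.smul_apply, smul_eq_mul]
    ring
  by_cases ha0 : a = 0
  · subst ha0
    convert hlin using 1
    funext t
    simp [hermitianWord, sq, tr]
  · convert Submodule.add_mem _ (Submodule.add_mem _ (Submodule.add_mem _ hlin (hQQ a ha ha0))
      (Submodule.smul_mem _ 2 (hQL a ha ha0 b))) (Submodule.smul_mem _ (2 * h) (hQ a ha ha0))
      using 1
    funext t
    simp only [Pi.add_apply, Pi.mul_apply, Pi.smul_apply, smul_eq_mul, hermitianWord, map_add,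
      tr, N]
    ring

/-- Polarization: `(f + g)² - (f - g)² = 4fg = fg` in characteristic 3. -/
theorem hermitianDesignCode_eq_mul (hK : Fintype.card K = 3 ^ (2 * m)) :
    hermitianDesignCode 3 m K = hermitianCode 3 m K * hermitianCode 3 m K := by
  refine le_antisymm hermitianDesignCode_le (Submodule.mul_le.mpr fun f hf g hg => ?_)
  have h := Submodule.sub_mem _ (word_mul_self_mem hK (Submodule.sub_mem _ hf hg))
    (word_mul_self_mem hK (Submodule.add_mem _ hf hg))
  have three : (3 : ZMod 3) = 0 := by decide
  convert Submodule.neg_mem _ h using 1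
  funext t
  simp only [Pi.neg_apply, Pi.sub_apply, Pi.mul_apply, Pi.add_apply]
  linear_combination -(f t * g t) * three

end HermitianWords

/-! ### Ternary digit vectors and the count of exponents -/

section Exponents

open scoped Pointwise

variable {m : ℕ}

/-- The unit vector at a ternary digit position; the position `(ε, j)` stands for `3 ^ (j + ε m)`. -/
def unitDigit {X : Type*} [DecidableEq X] (x : X) : X → ℕ := Pi.single x 1

/-- The digit vector of `(3 ^ m + 1) * 3 ^ j`. -/
def pairDigit (j : Fin m) : Fin 2 × Fin m → ℕ := unitDigit (0, j) + unitDigit (1, j)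

/-- The number with the given vector of ternary digits. -/
def digitValue (m : ℕ) : (Fin 2 × Fin m → ℕ) →+ ℕ where
  toFun d := ∑ x, d x * 3 ^ (finProdFinEquiv x : ℕ)
  map_zero' := by simp
  map_add' d e := by simp [add_mul, Finset.sum_add_distrib]

theorem digitValue_apply (d : Fin 2 × Fin m → ℕ) :
    digitValue m d = ∑ x, d x * 3 ^ (finProdFinEquiv x : ℕ) := rfl

theorem digitValue_unitDigit (x : Fin 2 × Fin m) :
    digitValue m (unitDigit x) = 3 ^ (finProdFinEquiv x : ℕ) := by
  simp [digitValue_apply, unitDigit, Pi.single_apply]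

theorem digitValue_pairDigit (j : Fin m) :
    digitValue m (pairDigit j) = (3 ^ m + 1) * 3 ^ (j : ℕ) := by
  rw [pairDigit, map_add, digitValue_unitDigit, digitValue_unitDigit]
  simp [finProdFinEquiv]
  ring

theorem digitValue_eq_finFunctionFinEquiv (d : Fin 2 × Fin m → Fin 3) :
    digitValue m (fun x => (d x : ℕ)) =
      finFunctionFinEquiv (fun i : Fin (2 * m) => d (finProdFinEquiv.symm i)) := by
  rw [finFunctionFinEquiv_apply, digitValue_apply]
  exact Fintype.sum_equiv finProdFinEquiv _ _ fun x => by simp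

theorem exists_fin_three {d : Fin 2 × Fin m → ℕ} (hd : ∀ x, d x < 3) :
    ∃ d' : Fin 2 × Fin m → Fin 3, d = fun x => (d' x : ℕ) :=
  ⟨fun x => ⟨d x, hd x⟩, rfl⟩

theorem digitValue_lt {d : Fin 2 × Fin m → ℕ} (hd : ∀ x, d x < 3) :
    digitValue m d < 3 ^ (2 * m) := by
  obtain ⟨d', rfl⟩ := exists_fin_three hd
  rw [digitValue_eq_finFunctionFinEquiv]
  exact Fin.is_lt _

theorem digitValue_injOn : Set.InjOn (digitValue m) {d | ∀ x, d x < 3} := by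
  intro d hd e he h
  obtain ⟨d', rfl⟩ := exists_fin_three hd
  obtain ⟨e', rfl⟩ := exists_fin_three he
  rw [digitValue_eq_finFunctionFinEquiv, digitValue_eq_finFunctionFinEquiv] at h
  have h' := finFunctionFinEquiv.injective (Fin.ext h)
  funext x
  simpa using congrArg Fin.val (congrFun h' (finProdFinEquiv x))

/-- The digit vectors of the exponents occurring in the Hermitian code. -/
def digitVectors (m : ℕ) : Finset (Fin 2 × Fin m → ℕ) :=
  insert 0 (Finset.univ.image unitDigit ∪ Finset.univ.image pairDigit)

theorem mem_digitVectors {d : Fin 2 × Fin m → ℕ} : d ∈ digitVectors m ↔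
    d = 0 ∨ (∃ x, unitDigit x = d) ∨ ∃ j, pairDigit j = d := by
  simp [digitVectors]

theorem unitDigit_le_one {X : Type*} [DecidableEq X] (x y : X) : unitDigit x y ≤ 1 := by
  unfold unitDigit
  rw [Pi.single_apply]
  split_ifs <;> simp

theorem unitDigit_eq_zero {X : Type*} [DecidableEq X] {x y : X} (h : y ≠ x) :
    unitDigit x y = 0 := Pi.single_eq_of_ne h 1

@[simp] theorem unitDigit_self {X : Type*} [DecidableEq X] (x : X) : unitDigit x x = 1 :=
  Pi.single_eq_same x 1

theorem le_one_of_mem_digitVectors {d : Fin 2 × Fin m → ℕ} (hd : d ∈ digitVectors m)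
    (x : Fin 2 × Fin m) : d x ≤ 1 := by
  rcases mem_digitVectors.mp hd with rfl | ⟨y, rfl⟩ | ⟨j, rfl⟩
  · simp
  · exact unitDigit_le_one y x
  · rw [pairDigit, Pi.add_apply]
    by_cases h : x = (0, j)
    · rw [unitDigit_eq_zero (x := ((1, j) : Fin 2 × Fin m)) (by rw [h]; simp)]
      exact unitDigit_le_one _ _
    · rw [unitDigit_eq_zero h, zero_add]
      exact unitDigit_le_one _ _

theorem lt_three_of_mem_digitVectors_add {d : Fin 2 × Fin m → ℕ}
    (hd : d ∈ digitVectors m + digitVectors m) (x : Fin 2 × Fin m) : d x < 3 := by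
  obtain ⟨e, he, f, hf, rfl⟩ := Finset.mem_add.mp hd
  have := le_one_of_mem_digitVectors he x
  have := le_one_of_mem_digitVectors hf x
  simp only [Pi.add_apply]
  omega

theorem unitDigit_injective {X : Type*} [DecidableEq X] :
    Function.Injective (unitDigit : X → X → ℕ) := by
  intro x y h
  by_contra hne
  have := congrFun h x
  rw [unitDigit_self, unitDigit_eq_zero hne] at this
  exact one_ne_zero this

theorem unitDigit_add_eq {X : Type*} [DecidableEq X] {x y x' y' : X}
    (h : unitDigit x + unitDigit y = unitDigit x' + unitDigit y') : s(x, y) = s(x', y') := by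
  by_cases h1 : x = x'
  · subst h1
    rw [unitDigit_injective (add_left_cancel h)]
  · by_cases h2 : x = y'
    · subst h2
      rw [add_comm (unitDigit x')] at h
      rw [unitDigit_injective (add_left_cancel h), Sym2.eq_swap]
    · have := congrFun h x
      simp [unitDigit_eq_zero h1, unitDigit_eq_zero h2] at this

theorem pairDigit_add_unitDigit_eq {j j' : Fin m} {x x' : Fin 2 × Fin m}
    (h : pairDigit j + unitDigit x = pairDigit j' + unitDigit x') : j = j' ∧ x = x' := by
  by_cases hj : j = j'
  · subst hj
    exact ⟨rfl, unitDigit_injective (add_left_cancel h)⟩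
  · exfalso
    -- The left side is positive at both `(0, j)` and `(1, j)`, where `pairDigit j'` vanishes; a
    -- single unit vector cannot cover both.
    have key : ∀ ε : Fin 2, x' = (ε, j) := by
      intro ε
      by_contra hne
      have h1 := congrFun h (ε, j)
      have h2 : pairDigit j' (ε, j) = 0 := by
        rw [pairDigit, Pi.add_apply, unitDigit_eq_zero (by simp [hj]),
          unitDigit_eq_zero (by simp [hj])]
      have h3 : 1 ≤ pairDigit j (ε, j) := by
        fin_cases ε <;> simp [pairDigit]
      simp only [Pi.add_apply, h2, unitDigit_eq_zero (Ne.symm hne)] at h1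
      omega
    have := (key 0).symm.trans (key 1)
    simp at this

theorem pairDigit_add_pairDigit_eq {j k j' k' : Fin m}
    (h : pairDigit j + pairDigit k = pairDigit j' + pairDigit k') : s(j, k) = s(j', k') := by
  have h0 : ∀ j i : Fin m, pairDigit j (0, i) = unitDigit j i := by
    intro j i
    by_cases hi : i = j
    · subst hi
      simp [pairDigit, unitDigit]
    · simp [pairDigit, unitDigit, hi]
  apply unitDigit_add_eq
  funext i
  simpa [h0] using congrFun h (0, i)

/-- A parametrization of the sums of two exponents of the Hermitian code. -/
def digitSums (m : ℕ) :
    Unit ⊕ (Fin 2 × Fin m) ⊕ Sym2 (Fin 2 × Fin m) ⊕ (Fin m × (Fin 2 × Fin m)) ⊕ Sym2 (Fin m) →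
      (Fin 2 × Fin m → ℕ) :=
  Sum.elim 0 <| Sum.elim unitDigit <|
    Sum.elim (Sym2.lift ⟨fun x y => unitDigit x + unitDigit y, fun _ _ => add_comm _ _⟩) <|
    Sum.elim (fun z => pairDigit z.1 + unitDigit z.2)
      (Sym2.lift ⟨fun j k => pairDigit j + pairDigit k, fun _ _ => add_comm _ _⟩)

theorem sum_unitDigit {X : Type*} [DecidableEq X] [Fintype X] (x : X) :
    ∑ y, unitDigit x y = 1 := by simp [unitDigit]

theorem sum_pairDigit (j : Fin m) : ∑ y, pairDigit j y = 2 := by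
  simp only [pairDigit, Pi.add_apply, Finset.sum_add_distrib, sum_unitDigit]

/-- The five summands have digit sums `0, 1, 2, 3, 4`, so only equalities within one summand remain.
-/
theorem digitSums_injective : Function.Injective (digitSums m) := by
  intro y z h
  have hs := congrArg (fun d : Fin 2 × Fin m → ℕ => ∑ x, d x) h
  rcases y with u | x | p | ⟨j, x⟩ | p <;> rcases z with u' | x' | p' | ⟨j', x'⟩ | p' <;>
    first
    | (induction p using Sym2.ind with | _ a b)
    | skip
  all_goals
    first
    | (induction p' using Sym2.ind with | _ a' b')
    | skip
  all_goals
    simp only [digitSums, Sum.elim_inl, Sum.elim_inr, Sym2.lift_mk, Pi.zero_apply, Pi.add_apply,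
      Finset.sum_add_distrib, sum_unitDigit, sum_pairDigit, Finset.sum_const_zero] at h hs
  all_goals first | omega | skip
  · rfl
  · rw [unitDigit_injective h]
  · rw [unitDigit_add_eq h]
  · obtain ⟨rfl, rfl⟩ := pairDigit_add_unitDigit_eq h
    rfl
  · rw [pairDigit_add_pairDigit_eq h]

theorem image_digitSums :
    Finset.univ.image (digitSums m) = digitVectors m + digitVectors m := by
  ext d
  simp only [Finset.mem_image, Finset.mem_univ, true_and, Finset.mem_add]
  have h0 : (0 : Fin 2 × Fin m → ℕ) ∈ digitVectors m := mem_digitVectors.mpr (Or.inl rfl)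
  have h1 : ∀ x, unitDigit x ∈ digitVectors m := fun x =>
    mem_digitVectors.mpr (Or.inr (Or.inl ⟨x, rfl⟩))
  have h2 : ∀ j, pairDigit j ∈ digitVectors m := fun j =>
    mem_digitVectors.mpr (Or.inr (Or.inr ⟨j, rfl⟩))
  constructor
  · rintro ⟨u | x | p | ⟨j, x⟩ | p, rfl⟩
    · exact ⟨0, h0, 0, h0, add_zero 0⟩
    · exact ⟨_, h1 x, 0, h0, add_zero _⟩
    · induction p using Sym2.ind with | _ a b
      exact ⟨_, h1 a, _, h1 b, rfl⟩
    · exact ⟨_, h2 j, _, h1 x, rfl⟩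
    · induction p using Sym2.ind with | _ a b
      exact ⟨_, h2 a, _, h2 b, rfl⟩
  · rintro ⟨e, he, f, hf, rfl⟩
    rcases mem_digitVectors.mp he with rfl | ⟨x, rfl⟩ | ⟨j, rfl⟩ <;>
      rcases mem_digitVectors.mp hf with rfl | ⟨y, rfl⟩ | ⟨k, rfl⟩
    · exact ⟨Sum.inl (), (add_zero 0).symm⟩
    · exact ⟨Sum.inr (Sum.inl y), (zero_add _).symm⟩
    -- A lone `pairDigit` is a sum of two unit vectors, so it needs no summand of its own.
    · exact ⟨Sum.inr (Sum.inr (Sum.inl s((0, k), (1, k)))), (zero_add _).symm⟩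
    · exact ⟨Sum.inr (Sum.inl x), (add_zero _).symm⟩
    · exact ⟨Sum.inr (Sum.inr (Sum.inl s(x, y))), rfl⟩
    · exact ⟨Sum.inr (Sum.inr (Sum.inr (Sum.inl (k, x)))), add_comm _ _⟩
    · exact ⟨Sum.inr (Sum.inr (Sum.inl s((0, j), (1, j)))), (add_zero _).symm⟩
    · exact ⟨Sum.inr (Sum.inr (Sum.inr (Sum.inl (j, y)))), rfl⟩
    · exact ⟨Sum.inr (Sum.inr (Sum.inr (Sum.inr s(j, k)))), rfl⟩

/-- The exponents occurring in the Hermitian code. -/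
def exponents (m : ℕ) : Finset ℕ := (digitVectors m).image (digitValue m)

theorem exponents_add_exponents :
    exponents m + exponents m = (digitVectors m + digitVectors m).image (digitValue m) :=
  (Finset.image_add (digitValue m)).symm

/-- Digits of vectors in `digitVectors m` are at most `1`, so sums of two have digits below `3`, and
distinct digit vectors give distinct numbers. -/
theorem card_exponents_add_exponents : (exponents m + exponents m).card =
    1 + 2 * m + (2 * m + 1).choose 2 + 2 * m ^ 2 + (m + 1).choose 2 := by
  rw [exponents_add_exponents, Finset.card_image_of_injOn, ← image_digitSums,
    Finset.card_image_of_injective _ digitSums_injective, Finset.card_univ]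
  · simp only [Fintype.card_sum, Fintype.card_prod, Fintype.card_fin, Fintype.card_unit, Sym2.card]
    ring
  · exact digitValue_injOn.mono fun d hd => lt_three_of_mem_digitVectors_add hd

theorem lt_of_mem_exponents_add {e : ℕ} (he : e ∈ exponents m + exponents m) :
    e < 3 ^ (2 * m) := by
  rw [exponents_add_exponents] at he
  obtain ⟨d, hd, rfl⟩ := Finset.mem_image.mp he
  exact digitValue_lt fun x => lt_three_of_mem_digitVectors_add hd x

theorem zero_mem_exponents : 0 ∈ exponents m :=
  Finset.mem_image.mpr ⟨0, mem_digitVectors.mpr (Or.inl rfl), map_zero _⟩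

theorem pow_mem_exponents {i : ℕ} (hi : i < 2 * m) : 3 ^ i ∈ exponents m :=
  Finset.mem_image.mpr ⟨unitDigit (finProdFinEquiv.symm ⟨i, hi⟩),
    mem_digitVectors.mpr (Or.inr (Or.inl ⟨_, rfl⟩)), by
      rw [digitValue_unitDigit, Equiv.apply_symm_apply]⟩

theorem mul_pow_mem_exponents {j : ℕ} (hj : j < m) : (3 ^ m + 1) * 3 ^ j ∈ exponents m :=
  Finset.mem_image.mpr ⟨pairDigit ⟨j, hj⟩,
    mem_digitVectors.mpr (Or.inr (Or.inr ⟨_, rfl⟩)), digitValue_pairDigit _⟩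

theorem mem_exponents {e : ℕ} (he : e ∈ exponents m) :
    e = 0 ∨ (∃ i < 2 * m, e = 3 ^ i) ∨ ∃ j < m, e = (3 ^ m + 1) * 3 ^ j := by
  obtain ⟨d, hd, rfl⟩ := Finset.mem_image.mp he
  rcases mem_digitVectors.mp hd with rfl | ⟨x, rfl⟩ | ⟨j, rfl⟩
  · exact Or.inl (map_zero _)
  · exact Or.inr (Or.inl ⟨_, (finProdFinEquiv x).is_lt, digitValue_unitDigit x⟩)
  · exact Or.inr (Or.inr ⟨j, j.is_lt, digitValue_pairDigit j⟩)

end Exponents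

/-! ### Ternary digit sums -/

section DigitSum

/-- By Legendre's formula this says that the `p`-adic valuation of `(a + b)! / (a! b!)` is
nonnegative. -/
theorem digits_sum_add_le (p : ℕ) [hp : Fact p.Prime] (a b : ℕ) :
    (p.digits (a + b)).sum ≤ (p.digits a).sum + (p.digits b).sum := by
  have h := sub_one_mul_padicValNat_factorial (p := p)
  have hdvd : a.factorial * b.factorial ∣ (a + b).factorial :=
    Nat.factorial_mul_factorial_dvd_factorial_add a b
  have hv : padicValNat p a.factorial + padicValNat p b.factorial ≤
      padicValNat p (a + b).factorial := by
    rw [← padicValNat.mul (Nat.factorial_ne_zero a) (Nat.factorial_ne_zero b)]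
    exact (padicValNat_dvd_iff_le (Nat.factorial_ne_zero _)).mp (pow_padicValNat_dvd.trans hdvd)
  have h3 := Nat.mul_le_mul_left (p - 1) hv
  rw [mul_add, h, h, h] at h3
  have := Nat.digit_sum_le p a
  have := Nat.digit_sum_le p b
  have := Nat.digit_sum_le p (a + b)
  omega

theorem digits_three_sum_eq (n : ℕ) :
    (Nat.digits 3 n).sum = n % 3 + (Nat.digits 3 (n / 3)).sum := by
  rcases Nat.eq_zero_or_pos n with rfl | hn
  · simp
  · rw [Nat.digits_def' (by norm_num) hn, List.sum_cons]

theorem digits_three_sum_split (s n : ℕ) :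
    (Nat.digits 3 n).sum = (Nat.digits 3 (n / 3 ^ s)).sum + (Nat.digits 3 (n % 3 ^ s)).sum := by
  induction s generalizing n with
  | zero => simp [Nat.mod_one]
  | succ s ih =>
    have h1 : n % 3 ^ (s + 1) % 3 = n % 3 := Nat.mod_mod_of_dvd n (dvd_pow_self 3 (by omega))
    have h2 : n % 3 ^ (s + 1) / 3 = n / 3 % 3 ^ s := by
      rw [pow_succ', Nat.mod_mul_right_div_self]
    have h3 : n / 3 ^ (s + 1) = n / 3 / 3 ^ s := by rw [pow_succ', Nat.div_div_eq_div_mul]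
    rw [digits_three_sum_eq n, digits_three_sum_eq (n % 3 ^ (s + 1)), h1, h2, h3, ih (n / 3)]
    ring

theorem digits_three_sum_pow_sub_one (s : ℕ) : (Nat.digits 3 (3 ^ s - 1)).sum = 2 * s := by
  induction s with
  | zero => simp
  | succ s ih =>
    have := Nat.pow_pos (n := s) (show 0 < 3 by norm_num)
    rw [digits_three_sum_eq, show (3 ^ (s + 1) - 1) / 3 = 3 ^ s - 1 by rw [pow_succ]; omega, ih,
      show (3 ^ (s + 1) - 1) % 3 = 2 by rw [pow_succ]; omega]
    ring

theorem digits_three_sum_lt {s n : ℕ} (hn : n < 3 ^ s - 1) : (Nat.digits 3 n).sum < 2 * s := by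
  induction s generalizing n with
  | zero => simp at hn
  | succ s ih =>
    rw [digits_three_sum_eq]
    rw [pow_succ] at hn
    rcases lt_or_ge (n / 3) (3 ^ s - 1) with h | h
    · have := ih h
      omega
    · have h' : n / 3 = 3 ^ s - 1 := by omega
      rw [h', digits_three_sum_pow_sub_one]
      omega

/-- A positive multiple of `3 ^ s - 1` has ternary digit sum at least `2 s`. -/
theorem le_digits_three_sum_of_dvd {s n : ℕ} (hn : 0 < n) (hdvd : 3 ^ s - 1 ∣ n) :
    2 * s ≤ (Nat.digits 3 n).sum := by
  induction n using Nat.strong_induction_on with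
  | _ n ih =>
    rcases Nat.eq_zero_or_pos s with rfl | hs
    · simp
    have h3 : 1 < 3 ^ s := Nat.one_lt_pow hs.ne' (by norm_num)
    rcases lt_or_ge n (3 ^ s) with hlt | hge
    · have := Nat.le_of_dvd hn hdvd
      rw [show n = 3 ^ s - 1 by omega, digits_three_sum_pow_sub_one]
    · have hq : 0 < n / 3 ^ s := Nat.div_pos hge (by omega)
      have hdm := Nat.div_add_mod n (3 ^ s)
      -- Since `3 ^ s` is `1` modulo `3 ^ s - 1`, adding the quotient to the remainder keeps
      -- divisibility, makes the number smaller, and does not raise the digit sum.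
      have heq : n = (3 ^ s - 1) * (n / 3 ^ s) + (n / 3 ^ s + n % 3 ^ s) := by
        obtain ⟨k, hk⟩ : ∃ k, 3 ^ s = k + 1 := ⟨3 ^ s - 1, by omega⟩
        rw [← hdm]
        conv_rhs => rw [hdm]
        rw [hk]
        simp only [Nat.add_sub_cancel]
        ring
      have hpos : 0 < (3 ^ s - 1) * (n / 3 ^ s) := Nat.mul_pos (by omega) hq
      have hdvd' : 3 ^ s - 1 ∣ n / 3 ^ s + n % 3 ^ s := by
        rw [heq] at hdvd
        exact (Nat.dvd_add_right (Dvd.intro _ rfl)).mp hdvd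
      have := ih _ (by omega) (by omega) hdvd'
      have := digits_sum_add_le 3 (n / 3 ^ s) (n % 3 ^ s)
      rw [digits_three_sum_split s n]
      omega

end DigitSum

/-! ### Extension of scalars for codes -/

section ScalarExtension

variable {F L X : Type*} [Field F] [Field L] [Algebra F L]

/-- The words over `F` as words over the extension field `L`. -/
def wordMap (F L X : Type*) [Field F] [Field L] [Algebra F L] : (X → F) →ₐ[F] (X → L) :=
  (Algebra.ofId F L).compLeft X

@[simp] theorem wordMap_apply (f : X → F) (t : X) :
    wordMap F L X f t = algebraMap F L (f t) := rfl

/-- The code over `L` spanned by a code over `F`. -/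
def extendScalars (L : Type*) [Field L] [Algebra F L] (M : Submodule F (X → F)) :
    Submodule L (X → L) :=
  Submodule.span L (wordMap F L X '' M)

theorem wordMap_mem_extendScalars {M : Submodule F (X → F)} {f : X → F} (hf : f ∈ M) :
    wordMap F L X f ∈ extendScalars L M := Submodule.subset_span ⟨f, hf, rfl⟩

/-- Each `F`-linear functional on `L` turns a relation over `L` into one over `F`, and functionals
separate points. -/
theorem linearIndependent_wordMap {κ : Type*} {v : κ → X → F} (hv : LinearIndependent F v) :
    LinearIndependent L fun i => wordMap F L X (v i) := by
  rw [linearIndependent_iff'] at hv ⊢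
  intro s g hg i hi
  refine (Module.forall_dual_apply_eq_zero_iff F (g i)).mp fun φ => ?_
  refine hv s (fun i => φ (g i)) ?_ i hi
  funext t
  have h := congrArg φ (congrFun hg t)
  simp only [Finset.sum_apply, Pi.smul_apply, wordMap_apply, smul_eq_mul, Pi.zero_apply,
    map_sum, map_zero] at h ⊢
  rw [← h]
  refine Finset.sum_congr rfl fun i _ => ?_
  rw [mul_comm (g i), ← Algebra.smul_def, map_smul, smul_eq_mul, mul_comm]

theorem finrank_extendScalars [Finite X] (M : Submodule F (X → F)) :
    Module.finrank L (extendScalars L M) = Module.finrank F M := by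
  let v := Module.finBasis F M
  have hli : LinearIndependent F fun i => (v i : X → F) :=
    v.linearIndependent.map' M.subtype M.ker_subtype
  have hspan : extendScalars L M =
      Submodule.span L (Set.range fun i => wordMap F L X (v i : X → F)) := by
    refine le_antisymm (Submodule.span_le.mpr ?_) (Submodule.span_le.mpr ?_)
    · rintro _ ⟨f, hf, rfl⟩
      have h := congrArg (fun x : M => wordMap F L X x) (v.sum_repr ⟨f, hf⟩)
      simp only [Submodule.coe_sum, map_sum, Submodule.coe_smul, map_smul] at h
      rw [← h]
      refine Submodule.sum_mem _ fun i _ => ?_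
      rw [← algebraMap_smul L]
      exact Submodule.smul_mem _ _ (Submodule.subset_span ⟨i, rfl⟩)
    · rintro _ ⟨i, rfl⟩
      exact wordMap_mem_extendScalars (v i).2
  rw [hspan, finrank_span_eq_card (linearIndependent_wordMap hli), Fintype.card_fin]

theorem extendScalars_mul (M N : Submodule F (X → F)) :
    extendScalars L (M * N) = extendScalars L M * extendScalars L N := by
  refine le_antisymm (Submodule.span_le.mpr ?_) ?_
  · rintro _ ⟨f, hf, rfl⟩
    refine Submodule.mul_induction_on hf (fun a ha b hb => ?_) fun a b ha hb => ?_
    · rw [map_mul]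
      exact Submodule.mul_mem_mul (wordMap_mem_extendScalars ha) (wordMap_mem_extendScalars hb)
    · rw [map_add]
      exact Submodule.add_mem _ ha hb
  · rw [extendScalars, extendScalars, Submodule.span_mul_span, Submodule.span_le]
    rintro _ ⟨_, ⟨a, ha, rfl⟩, _, ⟨b, hb, rfl⟩, rfl⟩
    simp only [← map_mul]
    exact wordMap_mem_extendScalars (Submodule.mul_mem_mul ha hb)

end ScalarExtension

/-! ### Spans of monomial functions -/

section Monomials

open scoped Pointwise

/-- The monomial function `t ↦ t ^ e`. -/
def monomialFun (K : Type*) [Monoid K] (e : ℕ) : K → K := fun t => t ^ e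

theorem monomialFun_mul (K : Type*) [Monoid K] (e f : ℕ) :
    monomialFun K e * monomialFun K f = monomialFun K (e + f) :=
  funext fun t => (pow_add t e f).symm

variable {K : Type*} [Field K]

theorem span_monomialFun_mul (S T : Finset ℕ) :
    Submodule.span K (monomialFun K '' S) * Submodule.span K (monomialFun K '' T) =
      Submodule.span K (monomialFun K '' (S + T : Finset ℕ)) := by
  rw [Submodule.span_mul_span]
  congr 1
  ext f
  constructor
  · rintro ⟨_, ⟨a, ha, rfl⟩, _, ⟨b, hb, rfl⟩, rfl⟩
    exact ⟨a + b, Finset.add_mem_add ha hb, (monomialFun_mul K a b).symm⟩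
  · rintro ⟨e, he, rfl⟩
    obtain ⟨a, ha, b, hb, rfl⟩ := Finset.mem_add.mp he
    exact ⟨_, ⟨a, ha, rfl⟩, _, ⟨b, hb, rfl⟩, monomialFun_mul K a b⟩

theorem linearIndependent_monomialFun [Fintype K] {T : Finset ℕ}
    (hT : ∀ e ∈ T, e < Fintype.card K) :
    LinearIndependent K fun e : T => monomialFun K e := by
  rw [Fintype.linearIndependent_iff]
  intro g hg e
  let P : Polynomial K := ∑ e : T, Polynomial.monomial (e : ℕ) (g e)
  have hP : P = 0 := by
    refine Polynomial.eq_zero_of_natDegree_lt_card_of_eval_eq_zero P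
      (f := fun t : K => t) Function.injective_id (fun t => ?_) ?_
    · have := congrFun hg t
      simpa [P, Polynomial.eval_finsetSum, monomialFun] using this
    · refine lt_of_le_of_lt (Polynomial.natDegree_sum_le_of_forall_le (n := Fintype.card K - 1)
        _ _ fun e _ => ?_) (Nat.sub_lt Fintype.card_pos one_pos)
      exact (Polynomial.natDegree_monomial_le _).trans (Nat.le_sub_one_of_lt (hT e e.2))
  have h := congrArg (fun Q => Polynomial.coeff Q e) hP
  simp only [P, Polynomial.finsetSum_coeff, Polynomial.coeff_monomial, Polynomial.coeff_zero] at h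
  rwa [Finset.sum_eq_single e (fun f _ hf => if_neg fun h => hf (Subtype.ext h))
    (fun he => absurd (Finset.mem_univ e) he), if_pos rfl] at h

theorem finrank_span_monomialFun [Fintype K] {T : Finset ℕ} (hT : ∀ e ∈ T, e < Fintype.card K) :
    Module.finrank K (Submodule.span K (monomialFun K '' T)) = T.card := by
  rw [Set.image_eq_range]
  exact (finrank_span_eq_card (linearIndependent_monomialFun hT)).trans (Fintype.card_coe T)

end Monomials

/-! ### Monomial bases over the large field and the dimension -/

section HermitianSpan

variable {K : Type*} [Field K] [Fintype K] [Algebra (ZMod 3) K] {m : ℕ}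

/-- A pair of bases dual with respect to the trace form. -/
theorem exists_trace_dual (S : Submodule (ZMod 3) K)
    (hS : ∀ y ∈ S, y ≠ 0 → ∃ a ∈ S, Algebra.trace (ZMod 3) K (a * y) ≠ 0) :
    ∃ (n : ℕ) (a b : Fin n → K), (∀ k, a k ∈ S) ∧
      ∀ y ∈ S, y = ∑ k, b k * algebraMap (ZMod 3) K (Algebra.trace (ZMod 3) K (a k * y)) := by
  let B : S →ₗ[ZMod 3] Module.Dual (ZMod 3) S :=
    (Algebra.traceForm (ZMod 3) K).domRestrict₁₂ S S
  have hB : ∀ x y : S, B x y = Algebra.trace (ZMod 3) K ((x : K) * y) := fun _ _ => rfl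
  have hinj : Function.Injective B := by
    rw [injective_iff_map_eq_zero]
    intro y hy
    by_contra hne
    obtain ⟨a, ha, h⟩ := hS y y.2 (by simpa using hne)
    apply h
    rw [mul_comm, ← hB y ⟨a, ha⟩, hy, LinearMap.zero_apply]
  have hsurj : Function.Surjective B :=
    (LinearMap.injective_iff_surjective_of_finrank_eq_finrank
      Subspace.dual_finrank_eq.symm).mp hinj
  let v := Module.finBasis (ZMod 3) S
  -- The `a k` are the trace-dual basis of `v`; it exists because the trace form is nondegenerate on
  -- `S`.
  choose a ha using fun k => hsurj (v.coord k)
  refine ⟨_, fun k => a k, fun k => v k, fun k => (a k).2, fun y hy => ?_⟩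
  have h := congrArg (fun x : S => (x : K)) (v.sum_repr ⟨y, hy⟩)
  simp only [Submodule.coe_sum, Submodule.coe_smul] at h
  conv_lhs => rw [← h]
  refine Finset.sum_congr rfl fun k _ => ?_
  rw [← hB (a k) ⟨y, hy⟩, ha, Module.Basis.coord_apply, Algebra.smul_def, mul_comm]

theorem finrank_eq_of_card (hK : Fintype.card K = 3 ^ (2 * m)) :
    Module.finrank (ZMod 3) K = 2 * m := by
  have h := Module.card_eq_pow_finrank (K := ZMod 3) (V := K)
  rw [ZMod.card, hK] at h
  exact (Nat.pow_right_injective (by norm_num) h).symm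

theorem algebraMap_trace_eq_sum (hK : Fintype.card K = 3 ^ (2 * m)) (x : K) :
    algebraMap (ZMod 3) K (Algebra.trace (ZMod 3) K x) =
      ∑ i ∈ Finset.range (2 * m), x ^ 3 ^ i := by
  rw [FiniteField.algebraMap_trace_eq_sum_pow, finrank_eq_of_card hK, Nat.card_zmod]

theorem extendScalars_hermitianCode_le (hK : Fintype.card K = 3 ^ (2 * m)) :
    extendScalars K (hermitianCode 3 m K) ≤ Submodule.span K (monomialFun K '' exponents m) := by
  have := charP_three_of_algebra K
  rw [extendScalars, Submodule.span_le]
  rintro _ ⟨_, ⟨a, b, h, -, rfl⟩, rfl⟩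
  have hmem : ∀ e ∈ exponents m,
      monomialFun K e ∈ Submodule.span K (monomialFun K '' exponents m) :=
    fun e he => Submodule.subset_span ⟨e, he, rfl⟩
  have hnorm : ∀ i < 2 * m, monomialFun K ((3 ^ m + 1) * 3 ^ i) ∈
      Submodule.span K (monomialFun K '' exponents m) := by
    intro i hi
    rcases lt_or_ge i m with him | him
    · exact hmem _ (mul_pow_mem_exponents him)
    -- The norm of `t` is fixed by the `3 ^ m`-th power, so exponents with `i ≥ m` repeat those with
    -- `i < m`.
    · obtain ⟨j, rfl⟩ := Nat.exists_eq_add_of_le him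
      convert hmem _ (mul_pow_mem_exponents (m := m) (j := j) (by omega)) using 1
      funext t
      simp only [monomialFun]
      rw [pow_mul, pow_add 3 m j, pow_mul, norm_mem_frobeniusFixed hK t, pow_mul]
  have hw : wordMap (ZMod 3) K K (hermitianWord 3 m K a b h) =
      ∑ i ∈ Finset.range (2 * m), a ^ 3 ^ i • monomialFun K ((3 ^ m + 1) * 3 ^ i) +
      ∑ i ∈ Finset.range (2 * m), b ^ 3 ^ i • monomialFun K (3 ^ i) +
      algebraMap (ZMod 3) K h • monomialFun K 0 := by
    funext t
    simp only [wordMap_apply, hermitianWord, map_add, algebraMap_trace_eq_sum hK, Pi.add_apply,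
      Finset.sum_apply, Pi.smul_apply, smul_eq_mul, monomialFun, pow_zero, mul_one, mul_pow,
      pow_mul]
  rw [hw]
  refine Submodule.add_mem _ (Submodule.add_mem _ (Submodule.sum_mem _ fun i hi => ?_)
    (Submodule.sum_mem _ fun i hi => ?_)) ?_
  · exact Submodule.smul_mem _ _ (hnorm i (Finset.mem_range.mp hi))
  · exact Submodule.smul_mem _ _ (hmem _ (pow_mem_exponents (Finset.mem_range.mp hi)))
  · exact Submodule.smul_mem _ _ (hmem _ zero_mem_exponents)

/-- Dual bases give `y = ∑ b k * Tr(a k * y)`, with `y = t` in `K` or `y = N t` in the subfield. The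
`3 ^ i`-th power leaves the traces unchanged and is additive. -/
theorem monomialFun_mem_extendScalars (hK : Fintype.card K = 3 ^ (2 * m)) {e : ℕ}
    (he : e ∈ exponents m) : monomialFun K e ∈ extendScalars K (hermitianCode 3 m K) := by
  have := charP_three_of_algebra K
  rcases mem_exponents he with rfl | ⟨i, -, rfl⟩ | ⟨i, -, rfl⟩
  · convert wordMap_mem_extendScalars (L := K)
      (hermitianWord_mem (m := m) (Submodule.zero_mem (frobeniusFixed m K)) 0 1) using 1
    funext t
    simp [monomialFun, hermitianWord]
  · obtain ⟨n, a, b, -, hab⟩ := exists_trace_dual (⊤ : Submodule (ZMod 3) K) fun y _ hy => by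
      obtain ⟨t, ht⟩ := trace_mul_surjective hy
      exact ⟨t, trivial, by rwa [mul_comm]⟩
    have h : monomialFun K (3 ^ i) = ∑ k, b k ^ 3 ^ i •
        wordMap (ZMod 3) K K (hermitianWord 3 m K 0 (a k) 0) := by
      funext t
      simp only [monomialFun]
      conv_lhs => rw [hab t trivial, sum_pow_char_pow]
      simp [hermitianWord, mul_pow, ← map_pow, ZMod.pow_card_pow]
    rw [h]
    exact Submodule.sum_mem _ fun k _ => Submodule.smul_mem _ _ (wordMap_mem_extendScalars
      (hermitianWord_mem (Submodule.zero_mem _) _ _))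
  · obtain ⟨n, a, b, ha, hab⟩ := exists_trace_dual (frobeniusFixed m K) fun y hy hy0 =>
      exists_frobeniusFixed_trace_mul_ne_zero hK hy hy0
    have h : monomialFun K ((3 ^ m + 1) * 3 ^ i) = ∑ k, b k ^ 3 ^ i •
        wordMap (ZMod 3) K K (hermitianWord 3 m K (a k) 0 0) := by
      funext t
      simp only [monomialFun]
      conv_lhs => rw [pow_mul, hab _ (norm_mem_frobeniusFixed hK t), sum_pow_char_pow]
      simp [hermitianWord, mul_pow, ← map_pow, ZMod.pow_card_pow]
    rw [h]
    exact Submodule.sum_mem _ fun k _ => Submodule.smul_mem _ _ (wordMap_mem_extendScalars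
      (hermitianWord_mem (ha k) _ _))

open scoped Pointwise

theorem extendScalars_hermitianDesignCode (hK : Fintype.card K = 3 ^ (2 * m)) :
    extendScalars K (hermitianDesignCode 3 m K) =
      Submodule.span K (monomialFun K '' (exponents m + exponents m : Finset ℕ)) := by
  have h : extendScalars K (hermitianCode 3 m K) =
      Submodule.span K (monomialFun K '' exponents m) :=
    le_antisymm (extendScalars_hermitianCode_le hK) (Submodule.span_le.mpr (by
      rintro _ ⟨e, he, rfl⟩
      exact monomialFun_mem_extendScalars hK he))
  rw [hermitianDesignCode_eq_mul hK, extendScalars_mul, h, span_monomialFun_mul]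

theorem finrank_hermitianDesignCode (hK : Fintype.card K = 3 ^ (2 * m)) :
    Module.finrank (ZMod 3) (hermitianDesignCode 3 m K) =
      1 + 2 * m + (2 * m + 1).choose 2 + 2 * m ^ 2 + (m + 1).choose 2 := by
  rw [← finrank_extendScalars (L := K), extendScalars_hermitianDesignCode hK,
    finrank_span_monomialFun fun e he => hK ▸ lt_of_mem_exponents_add he,
    card_exponents_add_exponents]

end HermitianSpan

/-! ### Vanishing moments and the minimum distance -/

section Moments

open scoped Pointwise

variable {K : Type*} [Field K] [Fintype K] [Algebra (ZMod 3) K] {m : ℕ}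

/-- A power sum over `K` can be nonzero only for positive multiples of `|K| - 1`, and those have
digit sum at least `4m`. For `j = 0` the sum is `|K|`, zero in `K`. -/
theorem sum_pow_eq_zero_of_digits_sum_lt (hK : Fintype.card K = 3 ^ (2 * m)) {j : ℕ}
    (hj : (Nat.digits 3 j).sum < 4 * m) : ∑ t : K, t ^ j = 0 := by
  classical
  have := charP_three_of_algebra K
  have hm : m ≠ 0 := by omega
  rcases Nat.eq_zero_or_pos j with rfl | hj0
  · simp only [pow_zero, Finset.sum_const, Finset.card_univ, nsmul_eq_mul, mul_one]
    rw [FiniteField.cast_card_eq_zero]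
  · have h := FiniteField.sum_pow_units K j
    rw [if_neg fun hdvd => ?_] at h
    · rw [Fintype.sum_eq_add_sum_compl (0 : K), zero_pow hj0.ne', zero_add]
      refine Eq.trans ?_ h
      refine (Finset.sum_bij (fun (u : Kˣ) _ => (u : K)) ?_ ?_ ?_ ?_).symm
      · intro u _
        simp
      · intro u _ v _ huv
        exact Units.ext huv
      · intro t ht
        exact ⟨Units.mk0 t (by simpa using ht), Finset.mem_univ _, rfl⟩
      · intro u _
        rfl
    · rw [hK] at hdvd
      have := le_digits_three_sum_of_dvd hj0 hdvd
      omega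

theorem digits_sum_le_four {e : ℕ} (he : e ∈ exponents m + exponents m) :
    (Nat.digits 3 e).sum ≤ 4 := by
  have h3 : ∀ i, (Nat.digits 3 (3 ^ i)).sum = 1 := by
    intro i
    induction i with
    | zero => simp
    | succ i ih => rw [digits_three_sum_eq, pow_succ, Nat.mul_mod_left,
        Nat.mul_div_cancel _ (by norm_num), ih]
  have h2 : ∀ e ∈ exponents m, (Nat.digits 3 e).sum ≤ 2 := by
    intro e he
    rcases mem_exponents he with rfl | ⟨i, -, rfl⟩ | ⟨i, -, rfl⟩
    · simp
    · rw [h3]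
      norm_num
    · have := digits_sum_add_le 3 (3 ^ (m + i)) (3 ^ i)
      rw [h3, h3] at this
      rwa [add_mul, ← pow_add, one_mul]
  obtain ⟨a, ha, b, hb, rfl⟩ := Finset.mem_add.mp he
  have := h2 a ha
  have := h2 b hb
  have := digits_sum_add_le 3 a b
  omega

/-- The moments of a word of the code of the design that are of small digit sum vanish. -/
theorem moment_eq_zero (hK : Fintype.card K = 3 ^ (2 * m)) {c : K → ZMod 3}
    (hc : c ∈ hermitianDesignCode 3 m K) {i : ℕ} (hi : (Nat.digits 3 i).sum + 4 < 4 * m) :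
    ∑ t : K, algebraMap (ZMod 3) K (c t) * t ^ i = 0 := by
  have h := wordMap_mem_extendScalars (L := K) hc
  rw [extendScalars_hermitianDesignCode hK] at h
  let φ : (K → K) →ₗ[K] K := ∑ t : K, t ^ i • LinearMap.proj t
  have hφ : ∀ f : K → K, φ f = ∑ t, f t * t ^ i := fun f => by
    simp [φ, LinearMap.sum_apply, mul_comm]
  have hle : Submodule.span K (monomialFun K '' (exponents m + exponents m : Finset ℕ)) ≤
      LinearMap.ker φ := by
    rw [Submodule.span_le]
    rintro _ ⟨e, he, rfl⟩
    rw [SetLike.mem_coe, LinearMap.mem_ker, hφ]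
    simp only [monomialFun, ← pow_add]
    refine sum_pow_eq_zero_of_digits_sum_lt hK ?_
    have := digits_sum_le_four he
    have := digits_sum_add_le 3 e i
    omega
  have := hle h
  rwa [LinearMap.mem_ker, hφ] at this

/-- A nonzero word whose first `N` power moments vanish has weight greater than `N`. -/
theorem lt_hammingNorm_of_moments {N : ℕ} {c : K → ZMod 3} (hc : c ≠ 0)
    (h : ∀ i < N, ∑ t : K, algebraMap (ZMod 3) K (c t) * t ^ i = 0) : N < hammingNorm c := by
  classical
  by_contra! hle
  obtain ⟨t₀, ht₀⟩ := Function.ne_iff.mp hc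
  rw [Pi.zero_apply] at ht₀
  -- `P` vanishes on the support except at `t₀`, so pairing it with `c` isolates a single nonzero
  -- term, although its degree is below `N`.
  let T : Finset K := (Finset.univ.filter fun t => c t ≠ 0).erase t₀
  let P : Polynomial K := ∏ s ∈ T, (Polynomial.X - Polynomial.C s)
  have hdeg : P.natDegree < N := by
    rw [Polynomial.natDegree_prod_of_monic _ _ fun s _ => Polynomial.monic_X_sub_C s]
    simp only [Polynomial.natDegree_X_sub_C, Finset.sum_const, smul_eq_mul, mul_one]
    refine lt_of_lt_of_le ?_ hle
    exact Finset.card_erase_lt_of_mem (by simpa using ht₀)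
  have hzero : ∑ t : K, algebraMap (ZMod 3) K (c t) * P.eval t = 0 := by
    simp only [Polynomial.eval_eq_sum_range' hdeg, Finset.mul_sum]
    rw [Finset.sum_comm]
    refine Finset.sum_eq_zero fun i hi => ?_
    rw [← mul_zero (P.coeff i), ← h i (Finset.mem_range.mp hi), Finset.mul_sum]
    exact Finset.sum_congr rfl fun t _ => by ring
  rw [Finset.sum_eq_single t₀] at hzero
  · rcases mul_eq_zero.mp hzero with h1 | h1
    · exact ht₀ (by simpa using h1)
    · rw [Polynomial.eval_prod, Finset.prod_eq_zero_iff] at h1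
      obtain ⟨s, hs, h2⟩ := h1
      rw [Polynomial.eval_sub, Polynomial.eval_X, Polynomial.eval_C, sub_eq_zero] at h2
      exact (Finset.mem_erase.mp hs).1 h2.symm
  · intro t _ hne
    by_cases hct : c t = 0
    · simp [hct]
    · have : P.eval t = 0 := by
        rw [Polynomial.eval_prod]
        exact Finset.prod_eq_zero (i := t) (Finset.mem_erase.mpr ⟨hne, by simpa using hct⟩)
          (by simp)
      rw [this, mul_zero]
  · simp

theorem le_minDist_hermitianDesignCode (hm : 1 ≤ m) (hK : Fintype.card K = 3 ^ (2 * m)) :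
    3 ^ (2 * m - 2) ≤ minDist (hermitianDesignCode 3 m K) := by
  -- For the zero code `minDist` would be `sInf ∅ = 0`; a positive dimension excludes this.
  have hne : ∃ c ∈ hermitianDesignCode 3 m K, c ≠ 0 := by
    refine (Submodule.ne_bot_iff _).mp fun h => ?_
    have := finrank_hermitianDesignCode (m := m) hK
    rw [h, finrank_bot] at this
    omega
  obtain ⟨c, hc, hc0⟩ := hne
  refine le_csInf ⟨_, c, hc, 0, Submodule.zero_mem _, hc0, rfl⟩ ?_
  rintro _ ⟨x, hx, y, hy, hxy, rfl⟩
  rw [hammingDist_comm, hammingDist_eq_hammingNorm, neg_add_eq_sub]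
  -- Every `i < 3 ^ (2m - 2) - 1` has digit sum below `4m - 4`, since some digit among its `2m - 2`
  -- places is not `2`.
  have := lt_hammingNorm_of_moments (N := 3 ^ (2 * m - 2) - 1) (sub_ne_zero.mpr hxy)
    fun i hi => moment_eq_zero hK (Submodule.sub_mem _ hx hy) (by
      have := digits_three_sum_lt hi
      omega)
  omega

end Moments

/-! ### Inclusion in the generalized Reed-Muller code -/

section ReedMullerInclusion

open Polynomial

variable {K : Type*} [Field K] [Fintype K] [Algebra (ZMod 3) K] {m : ℕ}

theorem snoc_pow_bijective {K : Type*} [Field K] [Fintype K] {n : ℕ}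
    (hK : Fintype.card K = n + 1) {ξ : K}
    (hξ : IsPrimitiveRoot ξ n) :
    Function.Bijective (Fin.snoc (α := fun _ => K) (fun i : Fin n => ξ ^ (i : ℕ)) 0) := by
  rw [Fintype.bijective_iff_injective_and_card, Fintype.card_fin, hK]
  refine ⟨?_, rfl⟩
  rw [Fin.snoc_injective_iff]
  refine ⟨fun i j h => Fin.ext (hξ.pow_inj i.is_lt j.is_lt h), ?_⟩
  rintro ⟨i, hi⟩
  have hn : n ≠ 0 := (Nat.zero_le (i : ℕ)).trans_lt i.is_lt |>.ne'
  exact pow_ne_zero _ (hξ.ne_zero hn) hi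

/-- The value of the word polynomial at `ξ ^ i` is the moment of order `i`, and the parity condition
is the moment of order `0`. -/
theorem hermitianDesignCode_le_grmCode (hm : 2 ≤ m) (hK : Fintype.card K = 3 ^ (2 * m)) {ξ : K}
    (hξ : IsPrimitiveRoot ξ (3 ^ (2 * m) - 1)) :
    hermitianDesignCode 3 m K ≤ grmCode 3 (2 * m) 4 ξ := by
  intro c hc
  have hpos : 1 < 3 ^ (2 * m) := Nat.one_lt_pow (by omega) (by norm_num)
  have hbij := snoc_pow_bijective (K := K) (n := 3 ^ (2 * m) - 1) (by omega) hξ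
  set σ := Fin.snoc (α := fun _ => K) (fun i : Fin (3 ^ (2 * m) - 1) => ξ ^ (i : ℕ)) 0 with hσ
  have hsum : ∀ f : K → K, ∑ i, f (σ i) = ∑ t, f t := fun f =>
    Fintype.sum_bijective σ hbij _ _ fun _ => rfl
  refine ⟨?_, ?_⟩
  · change grmGenerator 3 (2 * m) 4 ξ ∣ wordPoly 3 (fun i => c (σ i.castSucc))
    refine Finset.prod_dvd_of_coprime (fun i hi j hj hij => ?_) fun i hi => ?_
    · rw [Finset.mem_coe, Finset.mem_filter, Finset.mem_Icc] at hi hj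
      refine isCoprime_X_sub_C_of_isUnit_sub (sub_ne_zero.mpr fun h => hij ?_).isUnit
      exact hξ.pow_inj (by omega) (by omega) h
    · rw [Finset.mem_filter, Finset.mem_Icc] at hi
      rw [dvd_iff_isRoot, IsRoot.def]
      have hmom := moment_eq_zero hK hc (i := i) (by omega)
      rw [← hsum fun t => algebraMap (ZMod 3) K (c t) * t ^ i, Fin.sum_univ_castSucc] at hmom
      simp only [hσ, Fin.snoc_last, Fin.snoc_castSucc] at hmom
      -- The adjoined coordinate sits at the point `0` and drops out because `i ≥ 1`.
      rw [zero_pow (by omega), mul_zero, add_zero] at hmom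
      rw [← hmom]
      simp only [wordPoly, eval_finsetSum, eval_mul, eval_C, eval_pow, eval_X, hσ,
        Fin.snoc_castSucc]
      exact Finset.sum_congr rfl fun k _ => by rw [← pow_mul, ← pow_mul, mul_comm i]
  · change ∑ i, c (σ i) = 0
    -- Here `4 < 4m` is needed, hence `m ≥ 2`.
    have hmom := moment_eq_zero hK hc (i := 0) (by simp; omega)
    rw [← hsum fun t => algebraMap (ZMod 3) K (c t) * t ^ 0] at hmom
    simp only [pow_zero, mul_one, ← map_sum] at hmom
    exact (map_eq_zero _).mp hmom

end ReedMullerInclusion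

end DesignCode

theorem theorem3p16 (m : ℕ) (hm : 2 ≤ m) [Fintype (GaloisField 3 (2 * m))] :
    Fintype.card (GaloisField 3 (2 * m)) = 3 ^ (2 * m) ∧
    (Module.finrank (ZMod 3)
        (DesignCode.hermitianDesignCode 3 m (GaloisField 3 (2 * m))) : ℚ) =
      (9 * (m : ℚ) ^ 2 + 7 * m) / 2 + 1 ∧
    (∀ ξ : GaloisField 3 (2 * m), IsPrimitiveRoot ξ (3 ^ (2 * m) - 1) →
      DesignCode.hermitianDesignCode 3 m (GaloisField 3 (2 * m)) ≤
        DesignCode.grmCode 3 (2 * m) 4 ξ) ∧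
    3 ^ (2 * m - 2) ≤
      DesignCode.minDist (DesignCode.hermitianDesignCode 3 m (GaloisField 3 (2 * m))) := by
  have hK : Fintype.card (GaloisField 3 (2 * m)) = 3 ^ (2 * m) := by
    rw [Fintype.card_eq_nat_card, GaloisField.card 3 (2 * m) (by omega)]
  refine ⟨hK, ?_, fun ξ hξ => DesignCode.hermitianDesignCode_le_grmCode hm hK hξ,
    DesignCode.le_minDist_hermitianDesignCode (by omega) hK⟩
  rw [DesignCode.finrank_hermitianDesignCode hK]
  push_cast [Nat.cast_choose_two]
  ring
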